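/- For $n\in\mathbb{N}$ let $S_n$, $T_n$ and $I_n$ denote, respectively, the symmetric group, the full transformation monoid (all functions from $\{1,\ldots,n\}$ to itself, under composition) and the symmetric inverse monoid (all bijections between subsets of $\{1,\ldots,n\}$, under composition of binary relations) on $\{1,\ldots,n\}$. A subsemigroup $S$ of $T_n$ is monogenic if $S=\{s^k : k\geq 1\}$ for some $s\in S$, and a submonoid $M$ of $T_n$ is monogenic if $M=\{m^k : k\geq 0\}$ for some $m\in M$. A monogenic inverse subsemigroup (respectively, submonoid) of $I_n$ is one that is closed under inverses and is generated as a semigroup (respectively, as a monoid) by $\{x,x^{-1}\}$ for some element $x$ of it. Let $s(n)$ be the number of cyclic subgroups of $S_n$, $t(n)$ the number of monogenic submonoids of $T_n$, and $i(n)$ the number of monogenic inverse submonoids of $I_n$, each counted up to isomorphism. Then, for every $n\geq 2$, the number of monogenic subsemigroups of $T_n$, up to isomorphism, equals $t(n)-s(n-1)$; and, for every $n\geq 1$, the number of monogenic inverse subsemigroups of $I_n$, up to isomorphism, equals $i(n)-s(n-1)$. -/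

import Mathlib

/-- The equivalence relation "`F a` and `F b` are isomorphic" on the index type of a family of
objects with a multiplication.  Isomorphisms of semigroups, monoids, groups, inverse semigroups and
inverse monoids are all the same thing as bijections that preserve the multiplication. -/
def isoSetoid {ι : Type*} (F : ι → Type*) [∀ a, Mul (F a)] : Setoid ι where
  r a b := Nonempty (F a ≃* F b)
  iseqv :=
    { refl := fun a => ⟨MulEquiv.refl (F a)⟩
      symm := fun ⟨e⟩ => ⟨e.symm⟩
      trans := fun ⟨e⟩ ⟨f⟩ => ⟨e.trans f⟩ }

/-- The number of isomorphism types in a family of objects with a multiplication. -/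
noncomputable def numIsoTypes {ι : Type*} (F : ι → Type*) [∀ a, Mul (F a)] : ℕ :=
  Nat.card (Quotient (isoSetoid F))

/-- The symmetric inverse monoid on `α`: all bijections between subsets of `α`. -/
def SymmInvMonoid (α : Type*) : Type _ := α ≃. α

namespace SymmInvMonoid

/-- Composition of partial bijections (as binary relations, from left to right). -/
instance (α : Type*) : Monoid (SymmInvMonoid α) where
  mul f g := PEquiv.trans f g
  one := PEquiv.refl α
  mul_assoc f g h := PEquiv.trans_assoc f g h
  one_mul f := PEquiv.refl_trans f
  mul_one f := PEquiv.trans_refl f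

/-- The inverse partial bijection. -/
instance (α : Type*) : Inv (SymmInvMonoid α) where
  inv f := PEquiv.symm f

end SymmInvMonoid

/-- A subsemigroup `S` is monogenic if `S = {s ^ k | k > 0}` for some `s ∈ S`. -/
def Subsemigroup.IsMonogenic {M : Type*} [Monoid M] (S : Subsemigroup M) : Prop :=
  ∃ s ∈ S, (S : Set M) = {x | ∃ k : ℕ, 0 < k ∧ x = s ^ k}

/-- A submonoid `N` is monogenic if `N = {m ^ k | k ∈ ℕ}` for some `m ∈ N`. -/
def Submonoid.IsMonogenic {M : Type*} [Monoid M] (N : Submonoid M) : Prop :=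
  ∃ m ∈ N, (N : Set M) = {x | ∃ k : ℕ, x = m ^ k}

/-- A subsemigroup of the symmetric inverse monoid is a monogenic inverse subsemigroup if it is
closed under inverses and is generated, as a semigroup, by `s` and `s⁻¹` for some element `s`. -/
def Subsemigroup.IsMonogenicInverse {α : Type*} (S : Subsemigroup (SymmInvMonoid α)) : Prop :=
  (∀ x ∈ S, x⁻¹ ∈ S) ∧ ∃ s ∈ S, S = Subsemigroup.closure {s, s⁻¹}

/-- A submonoid of the symmetric inverse monoid is a monogenic inverse submonoid if it is
closed under inverses and is generated, as a monoid, by `m` and `m⁻¹` for some element `m`. -/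
def Submonoid.IsMonogenicInverse {α : Type*} (N : Submonoid (SymmInvMonoid α)) : Prop :=
  (∀ x ∈ N, x⁻¹ ∈ N) ∧ ∃ m ∈ N, N = Submonoid.closure {m, m⁻¹}

/-- `s(n)`: the number of isomorphism types of cyclic subgroups of the symmetric group `S_n`. -/
noncomputable def numCyclicSubgroups (n : ℕ) : ℕ :=
  numIsoTypes fun H : {H : Subgroup (Equiv.Perm (Fin n)) // IsCyclic H} => H.1

/-- `t(n)`: the number of isomorphism types of monogenic submonoids of the full transformation
monoid `T_n`. -/
noncomputable def numMonogenicSubmonoids (n : ℕ) : ℕ :=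
  numIsoTypes fun N : {N : Submonoid (Function.End (Fin n)) // N.IsMonogenic} => N.1

/-- `i(n)`: the number of isomorphism types of monogenic inverse submonoids of the symmetric
inverse monoid `I_n`. -/
noncomputable def numMonogenicInverseSubmonoids (n : ℕ) : ℕ :=
  numIsoTypes fun N : {N : Submonoid (SymmInvMonoid (Fin n)) // N.IsMonogenicInverse} => N.1

/-- The number of isomorphism types of monogenic subsemigroups of `T_n`. -/
noncomputable def numMonogenicSubsemigroups (n : ℕ) : ℕ :=
  numIsoTypes fun S : {S : Subsemigroup (Function.End (Fin n)) // S.IsMonogenic} => S.1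

/-- The number of isomorphism types of monogenic inverse subsemigroups of `I_n`. -/
noncomputable def numMonogenicInverseSubsemigroups (n : ℕ) : ℕ :=
  numIsoTypes fun S : {S : Subsemigroup (SymmInvMonoid (Fin n)) // S.IsMonogenicInverse} => S.1

/-! For a generator `s` in `T_n` or `I_n`, let `S` be the semigroup it generates and `N = S ∪ {1}`
the monoid. If `1 ∈ S`, then `s` is a unit and `N = S` is a cyclic group; otherwise `N` is `S` with
a new identity adjoined. Adjoining an identity is injective on isomorphism classes and never yields
a group. So if `A` and `B` are the sets of classes of `S` with `1 ∈ S` and `1 ∉ S`, there are `|A| +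
|B|` monoids and `|A ∪ B|` semigroups, and the difference is `|A ∩ B|`.

This intersection consists of the cyclic subgroups of `S_{n-1}`. A group in `B` has as identity an
idempotent other than `1`, and acts faithfully on the at most `n - 1` points fixed by it.
Conversely, `S_{n-1}` embeds both in the units, fixing the last point, and around an idempotent
other than `1`. `ncard_range_closure_add_numCyclicSubgroups` does this count for both monoids. -/

/-! ### Isomorphism classes and adjoined identities -/

/-- The isomorphism class of a type with a multiplication. -/
def isoClass (α : Type) [Mul α] : Quotient (isoSetoid fun X : MagmaCat.{0} => X) :=
  Quotient.mk _ (MagmaCat.of α)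

theorem isoClass_eq_iff {α β : Type} [Mul α] [Mul β] :
    isoClass α = isoClass β ↔ Nonempty (α ≃* β) :=
  Quotient.eq (r := isoSetoid fun X : MagmaCat.{0} => X)

/-- Places the types of different families in one common quotient, where they can be compared as
sets. -/
theorem numIsoTypes_eq_ncard {ι : Type*} (F : ι → Type) [∀ a, Mul (F a)] :
    numIsoTypes F = (Set.range fun a => isoClass (F a)).ncard := by
  have h : isoSetoid F = Setoid.ker fun a => isoClass (F a) := by
    ext a b
    exact isoClass_eq_iff.symm
  rw [numIsoTypes, h, ← Nat.card_coe_set_eq]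
  exact Nat.card_congr (Setoid.quotientKerEquivRange _)

/-- An isomorphism between semigroups with adjoined identities restricts to the semigroups. -/
theorem nonempty_mulEquiv_of_withOne {α β : Type*} [Mul α] [Mul β]
    (e : WithOne α ≃* WithOne β) : Nonempty (α ≃* β) := by
  have key : ∀ {α β : Type _} [Mul α] [Mul β] (e : WithOne α ≃* WithOne β) (a : α),
      ∃ b : β, (b : WithOne β) = e a := by
    intro α β _ _ e a
    refine WithOne.ne_one_iff_exists.1 fun h => ?_
    exact WithOne.coe_ne_one (e.injective (h.trans (map_one e).symm))
  choose f hf using key e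
  refine ⟨MulEquiv.ofBijective (⟨f, fun x y => ?_⟩ : α →ₙ* β) ⟨fun x y h => ?_, fun b => ?_⟩⟩
  · apply WithOne.coe_injective
    rw [hf, WithOne.coe_mul, WithOne.coe_mul, map_mul, hf, hf]
  · apply WithOne.coe_injective
    apply e.injective
    rw [← hf, ← hf]
    exact congrArg _ h
  · obtain ⟨a, ha⟩ : ∃ a : α, (a : WithOne α) = e.symm b := by
      refine WithOne.ne_one_iff_exists.1 fun h => ?_
      exact WithOne.coe_ne_one (e.symm.injective (h.trans (map_one e.symm).symm))
    refine ⟨a, WithOne.coe_injective ?_⟩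
    change ((f a : β) : WithOne β) = b
    rw [hf, ha, e.apply_symm_apply]

/-- Adjoining an identity, on isomorphism classes. -/
def isoClassWithOne : Quotient (isoSetoid fun X : MagmaCat.{0} => X) →
    Quotient (isoSetoid fun X : MagmaCat.{0} => X) :=
  Quotient.map' (fun X => MagmaCat.of (WithOne X)) fun _ _ ⟨e⟩ => ⟨e.withOneCongr⟩

theorem isoClassWithOne_isoClass (α : Type) [Mul α] :
    isoClassWithOne (isoClass α) = isoClass (WithOne α) := rfl

theorem isoClassWithOne_injective : Function.Injective isoClassWithOne := by
  intro a b
  induction a using Quotient.inductionOn with | _ X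
  induction b using Quotient.inductionOn with | _ Y
  intro h
  obtain ⟨e⟩ := isoClass_eq_iff.1 (h : isoClass (WithOne X) = isoClass (WithOne Y))
  exact Quotient.sound (nonempty_mulEquiv_of_withOne e)

/-- An element of `α` has no inverse in `WithOne α`: its products all stay in `α`. -/
theorem isoClass_group_ne_withOne (G α : Type) [Group G] [Mul α] [Nonempty α] :
    isoClass G ≠ isoClass (WithOne α) := by
  intro h
  obtain ⟨e⟩ := isoClass_eq_iff.1 h
  obtain ⟨a⟩ := ‹Nonempty α›
  have h1 : (a : WithOne α) * e (e.symm a)⁻¹ = 1 := by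
    conv_lhs => rw [← e.apply_symm_apply (a : WithOne α)]
    rw [e.symm_apply_apply, ← map_mul, mul_inv_cancel, map_one]
  generalize e (e.symm a)⁻¹ = c at h1
  induction c using WithOne.recOneCoe with
  | one => exact WithOne.coe_ne_one ((mul_one _).symm.trans h1)
  | coe b => exact WithOne.coe_ne_one ((WithOne.coe_mul a b).trans h1)

/-! ### Generated semigroups versus generated monoids -/

theorem mem_submonoidClosure_iff {M : Type*} [Monoid M] (s : Set M) (x : M) :
    x ∈ Submonoid.closure s ↔ x = 1 ∨ x ∈ Subsemigroup.closure s := by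
  constructor
  · intro hx
    induction hx using Submonoid.closure_induction with
    | mem x hx => exact Or.inr (Subsemigroup.subset_closure hx)
    | one => exact Or.inl rfl
    | mul x y _ _ hx hy =>
      rcases hx with rfl | hx
      · simpa using hy
      · rcases hy with rfl | hy
        · simpa using Or.inr hx
        · exact Or.inr (mul_mem hx hy)
  · rintro (rfl | hx)
    · exact one_mem _
    · exact (Subsemigroup.closure_le (S := (Submonoid.closure s).toSubsemigroup)).2
        Submonoid.subset_closure hx

theorem isoClass_submonoidClosure_of_one_mem {M : Type} [Monoid M] {s : Set M}
    (h : (1 : M) ∈ Subsemigroup.closure s) :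
    isoClass (Submonoid.closure s) = isoClass (Subsemigroup.closure s) := by
  have hm : ∀ x, x ∈ Submonoid.closure s ↔ x ∈ Subsemigroup.closure s := fun x => by
    rw [mem_submonoidClosure_iff]
    exact ⟨fun h' => h'.elim (fun e => e ▸ h) id, Or.inr⟩
  exact isoClass_eq_iff.2 ⟨{ Equiv.subtypeEquivRight hm with map_mul' := fun _ _ => rfl }⟩

theorem isoClass_submonoidClosure_of_one_notMem {M : Type} [Monoid M] {s : Set M}
    (h : (1 : M) ∉ Subsemigroup.closure s) :
    isoClass (Submonoid.closure s) = isoClass (WithOne (Subsemigroup.closure s)) := by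
  let φ : Subsemigroup.closure s →ₙ* Submonoid.closure s :=
    ⟨fun x => ⟨x, (mem_submonoidClosure_iff s _).2 (Or.inr x.2)⟩, fun _ _ => rfl⟩
  have hφ : ∀ x : Subsemigroup.closure s, WithOne.lift φ (x : WithOne _) = φ x :=
    WithOne.lift_coe φ
  refine (isoClass_eq_iff.2 ⟨MulEquiv.ofBijective (WithOne.lift φ) ⟨?_, ?_⟩⟩).symm
  · have hne : ∀ x : Subsemigroup.closure s, φ x ≠ 1 := fun x hx =>
      h (by have hx' : (x : M) = 1 := Subtype.ext_iff.1 hx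
            exact hx' ▸ x.2)
    intro x y hxy
    induction x using WithOne.recOneCoe with
    | one =>
      induction y using WithOne.recOneCoe with
      | one => rfl
      | coe y => rw [hφ, map_one] at hxy; exact absurd hxy.symm (hne y)
    | coe x =>
      induction y using WithOne.recOneCoe with
      | one => rw [hφ, map_one] at hxy; exact absurd hxy (hne x)
      | coe y =>
        rw [hφ, hφ] at hxy
        exact congrArg _ (Subtype.ext (congrArg Subtype.val hxy :))
  · rintro ⟨x, hx⟩
    rcases (mem_submonoidClosure_iff s x).1 hx with rfl | hx'
    · exact ⟨1, map_one _⟩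
    · exact ⟨((⟨x, hx'⟩ : Subsemigroup.closure s) : WithOne _), hφ _⟩

/-- In a finite monoid, the semigroup generated by a unit `s` and some powers of `s` is a cyclic
group. -/
theorem exists_isCyclic_isoClass_eq {M : Type} [Monoid M] [Finite M] {s : M} {g : Set M}
    (hs : s ∈ g) (hu : IsUnit s) (hg : g ⊆ Submonoid.powers s) :
    ∃ (G : Type) (_ : Group G) (_ : IsCyclic G),
      isoClass (Subsemigroup.closure g) = isoClass G := by
  obtain ⟨u, rfl⟩ := hu
  have hfin : IsOfFinOrder u := isOfFinOrder_of_finite u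
  refine ⟨Subgroup.zpowers u, inferInstance, inferInstance, isoClass_eq_iff.2 ⟨?_⟩⟩
  let φ : Subgroup.zpowers u →ₙ* M := ⟨fun x => ((x : Mˣ) : M), fun _ _ => by simp⟩
  have hφ : Function.Injective φ := fun x y h => Subtype.ext (Units.ext h)
  have hle : Subsemigroup.closure g ≤ MulHom.srange φ := by
    refine Subsemigroup.closure_le.2 fun x hx => ?_
    obtain ⟨k, rfl⟩ := hg hx
    exact ⟨⟨u ^ k, Subgroup.npow_mem_zpowers u k⟩, by simp [φ]⟩
  have hpow : ∀ k : ℕ, 0 < k → (u : M) ^ k ∈ Subsemigroup.closure g := by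
    intro k hk
    induction k, hk using Nat.le_induction with
    | base => simpa using Subsemigroup.subset_closure hs
    | succ k _ ih => rw [pow_succ]; exact mul_mem ih (Subsemigroup.subset_closure hs)
  have hge : ∀ x, φ x ∈ Subsemigroup.closure g := by
    rintro ⟨x, hx⟩
    obtain ⟨k, rfl⟩ := mem_powers_iff_mem_zpowers.2 hx
    change ((u ^ k : Mˣ) : M) ∈ _
    -- The exponent `k` may be `0`, but the semigroup closure only provides positive powers.
    have : u ^ k = u ^ (k + orderOf u) := by rw [pow_add, pow_orderOf_eq_one, mul_one]
    rw [this, Units.val_pow_eq_pow_val]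
    exact hpow _ (by have := hfin.orderOf_pos; omega)
  exact (MulEquiv.ofBijective
    (⟨fun x => ⟨φ x, hge x⟩, fun x y => Subtype.ext (map_mul φ x y)⟩ :
      Subgroup.zpowers u →ₙ* Subsemigroup.closure g)
    ⟨fun x y h => hφ (Subtype.ext_iff.1 h), fun x => by
      obtain ⟨y, hy⟩ := hle x.2
      exact ⟨y, Subtype.ext hy⟩⟩).symm

theorem isoClass_mem_range_of_injective {G : Type} [Group G] [IsCyclic G] {m : ℕ}
    (f : G →* Equiv.Perm (Fin m)) (hf : Function.Injective f) :
    isoClass G ∈ Set.range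
      fun H : {H : Subgroup (Equiv.Perm (Fin m)) // IsCyclic H} => isoClass H.1 :=
  ⟨⟨f.range, isCyclic_of_surjective f.rangeRestrict f.rangeRestrict_surjective⟩,
    isoClass_eq_iff.2 ⟨(MonoidHom.ofInjective hf).symm⟩⟩

/-- An embedding of a finite group sends the powers of `h` onto the subsemigroup generated by
`ψ h` and images of powers of `h`. -/
theorem isoClass_closure_of_injective {P M : Type} [Group P] [Finite P] [Monoid M]
    (ψ : P →ₙ* M) (hψ : Function.Injective ψ) (h : P) {g : Set M} (hs : ψ h ∈ g)
    (hg : g ⊆ ψ '' (Subgroup.zpowers h : Set P)) :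
    isoClass (Subsemigroup.closure g) = isoClass (Subgroup.zpowers h) ∧
      ψ 1 ∈ Subsemigroup.closure g ∧ (ψ 1 ≠ 1 → (1 : M) ∉ Subsemigroup.closure g) := by
  have hpow : ∀ k : ℕ, 0 < k → ψ (h ^ k) ∈ Subsemigroup.closure g := by
    intro k hk
    induction k, hk using Nat.le_induction with
    | base => simpa using Subsemigroup.subset_closure hs
    | succ k _ ih => rw [pow_succ, map_mul]; exact mul_mem ih (Subsemigroup.subset_closure hs)
  have hge : ∀ x : Subgroup.zpowers h, ψ x ∈ Subsemigroup.closure g := by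
    rintro ⟨x, hx⟩
    obtain ⟨k, rfl⟩ := mem_powers_iff_mem_zpowers.2 hx
    change ψ (h ^ k) ∈ _
    have : h ^ k = h ^ (k + orderOf h) := by rw [pow_add, pow_orderOf_eq_one, mul_one]
    rw [this]
    exact hpow _ (by have := orderOf_pos h; omega)
  have hle : ∀ x ∈ Subsemigroup.closure g, ∃ y : Subgroup.zpowers h, ψ y = x := by
    intro x hx
    have : Subsemigroup.closure g ≤ (Subgroup.zpowers h).toSubmonoid.toSubsemigroup.map ψ :=
      Subsemigroup.closure_le.2 hg
    obtain ⟨y, hy, rfl⟩ := this hx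
    exact ⟨⟨y, hy⟩, rfl⟩
  refine ⟨(isoClass_eq_iff.2 ⟨MulEquiv.ofBijective
    (⟨fun x => ⟨ψ x, hge x⟩, fun x y => Subtype.ext (map_mul ψ (x : P) y)⟩ :
      Subgroup.zpowers h →ₙ* Subsemigroup.closure g)
    ⟨fun x y e => Subtype.ext (hψ (Subtype.ext_iff.1 e)), fun x => by
      obtain ⟨y, hy⟩ := hle x x.2
      exact ⟨y, Subtype.ext hy⟩⟩⟩).symm, hge 1, fun hne h1 => ?_⟩
  -- If `1 = ψ y`, then `ψ 1 = ψ y * ψ 1 = ψ y = 1`.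
  obtain ⟨y, hy⟩ := hle 1 h1
  apply hne
  rw [← one_mul (ψ 1), ← hy, ← map_mul, mul_one]

/-! ### The counting principle -/

/-- The counting principle: `gen s` is the set of generators attached to an element `s` of a finite
monoid, and the isomorphism types shared by generated semigroups with and without the identity
are those of the cyclic subgroups of the symmetric group of degree `m`. -/
theorem ncard_range_closure_add_numCyclicSubgroups {M : Type} [Monoid M] [Finite M]
    (gen : M → Set M) (m : ℕ) (hself : ∀ s, s ∈ gen s)
    (hunit : ∀ s, (1 : M) ∈ Subsemigroup.closure (gen s) →
      IsUnit s ∧ gen s ⊆ Submonoid.powers s)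
    (hembed : ∀ (G : Type) [Group G] (φ : G →ₙ* M), Function.Injective φ → φ 1 ≠ 1 →
      ∃ f : G →* Equiv.Perm (Fin m), Function.Injective f)
    (ψ χ : Equiv.Perm (Fin m) →ₙ* M) (hψ : Function.Injective ψ) (hχ : Function.Injective χ)
    (hψ1 : ψ 1 = 1) (hχ1 : χ 1 ≠ 1)
    (hψg : ∀ h, gen (ψ h) ⊆ ψ '' (Subgroup.zpowers h : Set (Equiv.Perm (Fin m))))
    (hχg : ∀ h, gen (χ h) ⊆ χ '' (Subgroup.zpowers h : Set (Equiv.Perm (Fin m)))) :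
    (Set.range fun s => isoClass (Subsemigroup.closure (gen s))).ncard + numCyclicSubgroups m =
      (Set.range fun s => isoClass (Submonoid.closure (gen s))).ncard := by
  let F : M → Quotient (isoSetoid fun X : MagmaCat.{0} => X) :=
    fun s => isoClass (Subsemigroup.closure (gen s))
  let U : Set M := {s | (1 : M) ∈ Subsemigroup.closure (gen s)}
  have hA : (Set.range fun s => isoClass (Subsemigroup.closure (gen s))) = F '' U ∪ F '' Uᶜ := by
    rw [← Set.image_union, Set.union_compl_self, Set.image_univ]
  have hB : (Set.range fun s => isoClass (Submonoid.closure (gen s))) =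
      F '' U ∪ isoClassWithOne '' (F '' Uᶜ) := by
    rw [← Set.image_univ, ← Set.union_compl_self U, Set.image_union, Set.image_image]
    congr 1
    · exact Set.image_congr fun s hs => isoClass_submonoidClosure_of_one_mem hs
    · exact Set.image_congr fun s hs => isoClass_submonoidClosure_of_one_notMem hs
  have hgroup : ∀ s ∈ U, ∃ (G : Type) (_ : Group G) (_ : IsCyclic G), F s = isoClass G :=
    fun s hs => exists_isCyclic_isoClass_eq (hself s) (hunit s hs).1 (hunit s hs).2
  have hdisj : Disjoint (F '' U) (isoClassWithOne '' (F '' Uᶜ)) := by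
    rw [Set.disjoint_left]
    rintro _ ⟨s, hs, rfl⟩ ⟨_, ⟨t, _, rfl⟩, h⟩
    obtain ⟨G, _, _, hG⟩ := hgroup s hs
    have : Nonempty (Subsemigroup.closure (gen t)) :=
      ⟨⟨t, Subsemigroup.subset_closure (hself t)⟩⟩
    exact isoClass_group_ne_withOne G _ (hG.symm.trans h.symm)
  have hC : numCyclicSubgroups m = (F '' U ∩ F '' Uᶜ).ncard := by
    rw [numCyclicSubgroups, numIsoTypes_eq_ncard]
    congr 1
    apply Set.Subset.antisymm
    · rintro _ ⟨⟨H, hH⟩, rfl⟩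
      obtain ⟨h, rfl⟩ := Subgroup.isCyclic_iff_exists_zpowers_eq_top H |>.1 hH
      obtain ⟨h1, h2, -⟩ := isoClass_closure_of_injective ψ hψ h (hself _) (hψg h)
      obtain ⟨h3, -, h4⟩ := isoClass_closure_of_injective χ hχ h (hself _) (hχg h)
      exact ⟨⟨ψ h, (hψ1 ▸ h2 : (1 : M) ∈ Subsemigroup.closure (gen (ψ h))), h1⟩, ⟨χ h, h4 hχ1, h3⟩⟩
    · rintro _ ⟨⟨s, hs, rfl⟩, ⟨t, ht, hst⟩⟩
      obtain ⟨G, _, _, hG⟩ := hgroup s hs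
      obtain ⟨e⟩ := isoClass_eq_iff.1 (hG.symm.trans hst.symm)
      -- The group `G` is realised inside the semigroup of `t`, which omits `1`, so its identity is
      -- sent to an idempotent other than `1`.
      obtain ⟨f, hf⟩ := hembed G
        ((MulMemClass.subtype (Subsemigroup.closure (gen t))).comp (e : G →ₙ* _))
        (Subtype.val_injective.comp e.injective)
        (fun h => ht (by
          have h' : ((e 1 : Subsemigroup.closure (gen t)) : M) = 1 := h
          exact (h' ▸ (e 1).2 : (1 : M) ∈ Subsemigroup.closure (gen t))))
      rw [hG]
      exact isoClass_mem_range_of_injective f hf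
  rw [hA, hB, hC, Set.ncard_union_eq hdisj (Set.toFinite _) (Set.toFinite _),
    Set.ncard_image_of_injective _ isoClassWithOne_injective,
    Set.ncard_union_add_ncard_inter _ _ (Set.toFinite _) (Set.toFinite _)]

/-- A group acting faithfully on a set with at most `m` points embeds into `S_m`. -/
theorem exists_injective_perm_fin {G Y : Type*} [Group G] [Finite Y] (a : G → Y → Y) (X : Set Y)
    {m : ℕ} (hm : X.ncard ≤ m) (hX : ∀ g, ∀ y ∈ X, a g y ∈ X) (hone : ∀ y ∈ X, a 1 y = y)
    (hmul : ∀ g h, ∀ y ∈ X, a (g * h) y = a g (a h y))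
    (hinj : ∀ g h, (∀ y ∈ X, a g y = a h y) → g = h) :
    ∃ f : G →* Equiv.Perm (Fin m), Function.Injective f := by
  let _ : MulAction G X :=
    { smul := fun g y => ⟨a g y, hX g y y.2⟩
      one_smul := fun y => Subtype.ext (hone y y.2)
      mul_smul := fun g h y => Subtype.ext (hmul g h y y.2) }
  have := Fintype.ofFinite X
  obtain ⟨ι⟩ : Nonempty (X ↪ Fin m) := by
    apply Function.Embedding.nonempty_of_card_le
    rwa [Fintype.card_fin, ← Nat.card_eq_fintype_card, Nat.card_coe_set_eq]
  refine ⟨(Equiv.Perm.viaEmbeddingHom ι).comp (MulAction.toPermHom G X),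
    (Equiv.Perm.viaEmbeddingHom_injective ι).comp fun g h e => hinj g h fun y hy => ?_⟩
  exact congrArg Subtype.val (DFunLike.congr_fun e ⟨y, hy⟩ :)

/-! ### Monogenic subsemigroups of the full transformation monoid -/

theorem Subsemigroup.mem_closure_singleton_iff_exists_pow {M : Type*} [Monoid M] {s x : M} :
    x ∈ Subsemigroup.closure {s} ↔ ∃ k : ℕ, 0 < k ∧ x = s ^ k := by
  constructor
  · intro hx
    induction hx using Subsemigroup.closure_induction with
    | mem x hx => exact ⟨1, one_pos, by simpa using hx⟩
    | mul x y _ _ hx hy =>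
      obtain ⟨k, hk, rfl⟩ := hx
      obtain ⟨l, _, rfl⟩ := hy
      exact ⟨k + l, by omega, (pow_add s k l).symm⟩
  · rintro ⟨k, hk, rfl⟩
    induction k, hk using Nat.le_induction with
    | base => simpa using Subsemigroup.subset_closure (Set.mem_singleton s)
    | succ k _ ih =>
      rw [pow_succ]
      exact mul_mem ih (Subsemigroup.subset_closure (Set.mem_singleton s))

theorem Subsemigroup.isMonogenic_iff {M : Type*} [Monoid M] (S : Subsemigroup M) :
    S.IsMonogenic ↔ ∃ s, S = Subsemigroup.closure {s} := by
  constructor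
  · rintro ⟨s, -, h⟩
    refine ⟨s, SetLike.ext fun x => ?_⟩
    rw [Subsemigroup.mem_closure_singleton_iff_exists_pow, ← SetLike.mem_coe, h]
    rfl
  · rintro ⟨s, rfl⟩
    exact ⟨s, Subsemigroup.subset_closure rfl,
      Set.ext fun x => Subsemigroup.mem_closure_singleton_iff_exists_pow⟩

theorem Submonoid.isMonogenic_iff {M : Type*} [Monoid M] (N : Submonoid M) :
    N.IsMonogenic ↔ ∃ s, N = Submonoid.closure {s} := by
  constructor
  · rintro ⟨s, -, h⟩
    refine ⟨s, SetLike.ext fun x => ?_⟩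
    rw [Submonoid.mem_closure_singleton, ← SetLike.mem_coe, h]
    exact exists_congr fun _ => eq_comm
  · rintro ⟨s, rfl⟩
    refine ⟨s, Submonoid.subset_closure rfl, Set.ext fun x => ?_⟩
    rw [SetLike.mem_coe, Submonoid.mem_closure_singleton]
    exact exists_congr fun _ => eq_comm

/-- Isomorphism types in a family of substructures parametrised by `c`. -/
theorem numIsoTypes_subtype {M A : Type} [SetLike A M] [∀ S : A, Mul S] {p : A → Prop}
    (c : M → A) (hp : ∀ S, p S ↔ ∃ s, S = c s) :
    numIsoTypes (fun S : {S : A // p S} => S.1) = (Set.range fun s => isoClass (c s)).ncard := by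
  rw [numIsoTypes_eq_ncard]
  congr 1
  ext x
  constructor
  · rintro ⟨⟨S, hS⟩, rfl⟩
    obtain ⟨s, rfl⟩ := (hp S).1 hS
    exact ⟨s, rfl⟩
  · rintro ⟨s, rfl⟩
    exact ⟨⟨c s, (hp _).2 ⟨s, rfl⟩⟩, rfl⟩

/-- `G` acts on the fixed points of the idempotent `φ 1`, a proper subset. The action is faithful
because `φ g = φ g ∘ φ 1` is determined on the image of `φ 1`. -/
theorem exists_injective_perm_fin_of_end {m : ℕ} {G : Type} [Group G]
    (φ : G →ₙ* Function.End (Fin (m + 1))) (hφ : Function.Injective φ) (h1 : φ 1 ≠ 1) :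
    ∃ f : G →* Equiv.Perm (Fin m), Function.Injective f := by
  have hm : ∀ g h y, φ g (φ h y) = φ (g * h) y := fun g h y => by rw [map_mul]; rfl
  refine exists_injective_perm_fin (fun g => φ g) {y | φ 1 y = y} ?_ ?_ ?_ ?_ ?_
  · have : {y | φ 1 y = y} ⊂ Set.univ :=
      Set.ssubset_univ_iff.2 fun h => h1 (funext fun y => (Set.eq_univ_iff_forall.1 h y :))
    have := Set.ncard_lt_ncard this
    rw [Set.ncard_univ, Nat.card_eq_fintype_card, Fintype.card_fin] at this
    omega
  · intro g y _
    rw [Set.mem_ofPred, hm, one_mul]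
  · exact fun y hy => hy
  · exact fun g h y _ => (hm g h y).symm
  · refine fun g h e => hφ (funext fun y => ?_)
    have := e (φ 1 y) (by rw [Set.mem_ofPred, hm, one_mul])
    rwa [hm, hm, mul_one, mul_one] at this

theorem isUnit_of_one_mem_closure_singleton {M : Type*} [Monoid M] {s : M}
    (h : (1 : M) ∈ Subsemigroup.closure {s}) : IsUnit s := by
  obtain ⟨k, hk, e⟩ := Subsemigroup.mem_closure_singleton_iff_exists_pow.1 h
  exact IsUnit.of_pow_eq_one e.symm hk.ne'

theorem numMonogenicSubsemigroups_add_numCyclicSubgroups (m : ℕ) (hm : 1 ≤ m) :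
    numMonogenicSubsemigroups (m + 1) + numCyclicSubgroups m = numMonogenicSubmonoids (m + 1) := by
  have hS : numMonogenicSubsemigroups (m + 1) =
      (Set.range fun s : Function.End (Fin (m + 1)) => isoClass (Subsemigroup.closure {s})).ncard := by
    refine Eq.trans ?_
      (numIsoTypes_subtype (fun s => Subsemigroup.closure {s}) Subsemigroup.isMonogenic_iff)
    rfl
  have hN : numMonogenicSubmonoids (m + 1) =
      (Set.range fun s : Function.End (Fin (m + 1)) => isoClass (Submonoid.closure {s})).ncard :=
    numIsoTypes_subtype (fun s => Submonoid.closure {s}) Submonoid.isMonogenic_iff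
  rw [hS, hN]
  -- The retraction `ρ` must send the last point somewhere in `Fin m`. For `m = 0` the only self-map
  -- is the identity, so no `χ` with `χ 1 ≠ 1` exists.
  have : NeZero m := ⟨by omega⟩
  let ρ : Fin (m + 1) → Fin m := Function.invFun Fin.castSucc
  have hρ : ∀ x : Fin m, ρ x.castSucc = x :=
    Function.leftInverse_invFun (Fin.castSucc_injective m)
  have : Finite (Function.End (Fin (m + 1))) := inferInstanceAs (Finite (Fin (m + 1) → Fin (m + 1)))
  let ψ : Equiv.Perm (Fin m) →ₙ* Function.End (Fin (m + 1)) :=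
    ⟨fun f => (Equiv.Perm.viaEmbeddingHom Fin.castSuccEmb f : Fin (m + 1) → Fin (m + 1)),
      fun f g => by rw [map_mul]; rfl⟩
  let χ : Equiv.Perm (Fin m) →ₙ* Function.End (Fin (m + 1)) :=
    ⟨fun f x => (f (ρ x)).castSucc, fun f g => funext fun x => by
      change ((f * g) (ρ x)).castSucc = (f (ρ (g (ρ x)).castSucc)).castSucc
      rw [hρ]
      rfl⟩
  refine ncard_range_closure_add_numCyclicSubgroups (fun s => {s}) m (fun s => rfl)
    (fun s h => ⟨isUnit_of_one_mem_closure_singleton h,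
      Set.singleton_subset_iff.2 (Submonoid.mem_powers s)⟩)
    (fun G _ => exists_injective_perm_fin_of_end) ψ χ ?_ ?_ ?_ ?_ ?_ ?_
  · exact fun f g h => Equiv.Perm.viaEmbeddingHom_injective _ (Equiv.coe_fn_injective h)
  · intro f g h
    ext1 x
    have := congrFun h x.castSucc
    change (f (ρ x.castSucc)).castSucc = (g (ρ x.castSucc)).castSucc at this
    rw [hρ] at this
    exact Fin.castSucc_injective m this
  · change ⇑(Equiv.Perm.viaEmbeddingHom Fin.castSuccEmb (1 : Equiv.Perm (Fin m))) = id
    rw [map_one]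
    rfl
  · exact fun h => Fin.castSucc_ne_last _ (congrFun h (Fin.last m))
  · exact fun h => Set.singleton_subset_iff.2 ⟨h, Subgroup.mem_zpowers h, rfl⟩
  · exact fun h => Set.singleton_subset_iff.2 ⟨h, Subgroup.mem_zpowers h, rfl⟩

/-! ### Monogenic inverse subsemigroups of the symmetric inverse monoid -/

namespace SymmInvMonoid

variable {α : Type*}

instance [Finite α] : Finite (SymmInvMonoid α) :=
  Finite.of_injective (β := α → Option α) (fun f => (show α ≃. α from f))
    (DFunLike.coe_injective (F := α ≃. α))

theorem mul_inv_mul (s : SymmInvMonoid α) : s * s⁻¹ * s = s := by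
  have key : ∀ f : α ≃. α, (f.trans f.symm).trans f = f := by
    refine fun f => PEquiv.ext fun a => Option.ext fun b => ?_
    rw [PEquiv.self_trans_symm, ← Option.mem_def, PEquiv.mem_trans]
    simp only [PEquiv.mem_ofSet_iff]
    constructor
    · rintro ⟨c, ⟨rfl, -⟩, h⟩
      exact h
    · exact fun h => ⟨a, ⟨rfl, by rw [Set.mem_ofPred, Option.mem_def.1 h]; rfl⟩, h⟩
  exact key s

theorem inv_inv (s : SymmInvMonoid α) : s⁻¹⁻¹ = s := PEquiv.symm_symm s

theorem mul_inv_rev (s t : SymmInvMonoid α) : (s * t)⁻¹ = t⁻¹ * s⁻¹ := rfl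

theorem mul_inv_eq_one_of_isUnit {s : SymmInvMonoid α} (h : IsUnit s) : s * s⁻¹ = 1 :=
  h.mul_right_cancel ((mul_inv_mul s).trans (one_mul s).symm)

theorem isUnit_of_isUnit_inv [Finite α] {s : SymmInvMonoid α} (h : IsUnit s⁻¹) : IsUnit s := by
  have := mul_inv_eq_one_of_isUnit h
  rw [inv_inv] at this
  exact IsUnit.of_mul_eq_one_right _ this

/-- In a finite monoid a factor of a unit is a unit, so the first letter of a word equal to `1`,
either `s` or `s⁻¹`, is one. -/
theorem isUnit_of_one_mem_closure [Finite α] {s : SymmInvMonoid α}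
    (h : 1 ∈ Subsemigroup.closure {s, s⁻¹}) : IsUnit s := by
  suffices ∀ x ∈ Subsemigroup.closure {s, s⁻¹}, IsUnit x → IsUnit s from this 1 h isUnit_one
  intro x hx
  induction hx using Subsemigroup.closure_induction with
  | mem x hx =>
    rcases hx with rfl | rfl
    · exact id
    · exact isUnit_of_isUnit_inv
  | mul x y _ _ hx _ => exact fun h => hx (isUnit_of_mul_isUnit_left h)

theorem inv_mem_powers [Finite α] {s : SymmInvMonoid α} (h : IsUnit s) :
    s⁻¹ ∈ Submonoid.powers s := by
  obtain ⟨k, hk, e⟩ := h.isOfFinOrder.exists_pow_eq_one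
  refine ⟨k - 1, h.mul_left_cancel ?_⟩
  dsimp only
  rw [mul_inv_eq_one_of_isUnit h, ← pow_succ', Nat.sub_add_cancel hk, e]

end SymmInvMonoid

theorem Subsemigroup.isMonogenicInverse_iff {α : Type*} (S : Subsemigroup (SymmInvMonoid α)) :
    S.IsMonogenicInverse ↔ ∃ s, S = Subsemigroup.closure {s, s⁻¹} := by
  constructor
  · rintro ⟨-, s, -, h⟩
    exact ⟨s, h⟩
  · rintro ⟨s, rfl⟩
    refine ⟨fun x hx => ?_, s, Subsemigroup.subset_closure (Or.inl rfl), rfl⟩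
    induction hx using Subsemigroup.closure_induction with
    | mem x hx =>
      rcases hx with rfl | rfl
      · exact Subsemigroup.subset_closure (Or.inr rfl)
      · exact Subsemigroup.subset_closure (Or.inl (SymmInvMonoid.inv_inv s))
    | mul x y _ _ hx hy =>
      rw [SymmInvMonoid.mul_inv_rev]
      exact mul_mem hy hx

theorem Submonoid.isMonogenicInverse_iff {α : Type*} (N : Submonoid (SymmInvMonoid α)) :
    N.IsMonogenicInverse ↔ ∃ s, N = Submonoid.closure {s, s⁻¹} := by
  constructor
  · rintro ⟨-, s, -, h⟩
    exact ⟨s, h⟩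
  · rintro ⟨s, rfl⟩
    refine ⟨fun x hx => ?_, s, Submonoid.subset_closure (Or.inl rfl), rfl⟩
    induction hx using Submonoid.closure_induction with
    | mem x hx =>
      rcases hx with rfl | rfl
      · exact Submonoid.subset_closure (Or.inr rfl)
      · exact Submonoid.subset_closure (Or.inl (SymmInvMonoid.inv_inv s))
    | one => exact one_mem _
    | mul x y _ _ hx hy =>
      rw [SymmInvMonoid.mul_inv_rev]
      exact mul_mem hy hx

theorem exists_injective_perm_fin_of_symmInvMonoid {m : ℕ} {G : Type} [Group G]
    (φ : G →ₙ* SymmInvMonoid (Fin (m + 1))) (hφ : Function.Injective φ) (h1 : φ 1 ≠ 1) :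
    ∃ f : G →* Equiv.Perm (Fin m), Function.Injective f := by
  -- Partial maps become total on `Option`, with `none` for undefined. Composition runs left to
  -- right, so `b` is a right action; using `g⁻¹` below turns it into a left one.
  let b : G → Option (Fin (m + 1)) → Option (Fin (m + 1)) :=
    fun g y => y.bind (show Fin (m + 1) ≃. Fin (m + 1) from φ g)
  have hb : ∀ g h y, b h (b g y) = b (g * h) y := by
    intro g h y
    simp only [b, map_mul]
    exact Option.bind_assoc _ _ _
  have hnone : ∀ g, b g none = none := fun g => rfl
  have hext : ∀ g h, (∀ x, b g (some x) = b h (some x)) → φ g = φ h :=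
    fun g h e => PEquiv.ext fun x => e x
  refine exists_injective_perm_fin (fun g => b g⁻¹) {y | b 1 y = y ∧ y ≠ none} ?_ ?_ ?_ ?_ ?_
  · have hss : some ⁻¹' {y | b 1 y = y ∧ y ≠ none} ⊂ (Set.univ : Set (Fin (m + 1))) := by
      refine Set.ssubset_univ_iff.2 fun h => h1 (PEquiv.ext fun x => ?_)
      exact (Set.eq_univ_iff_forall.1 h x).1
    have hlt := Set.ncard_lt_ncard hss
    rw [Set.ncard_univ, Nat.card_eq_fintype_card, Fintype.card_fin,
      Set.ncard_preimage_of_injective_subset_range (Option.some_injective _)] at hlt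
    · omega
    · rintro y ⟨-, hy⟩
      exact Option.ne_none_iff_exists.1 hy
  · rintro g y ⟨hy, hn⟩
    refine ⟨by rw [hb, mul_one], fun h => hn ?_⟩
    have := congrArg (b g) h
    rwa [hb, inv_mul_cancel, hy] at this
  · rintro y ⟨hy, -⟩
    rw [inv_one, hy]
  · intro g h y _
    rw [hb, mul_inv_rev]
  · refine fun g h e => inv_injective (hφ (hext _ _ fun x => ?_))
    have key : b g⁻¹ (b 1 (some x)) = b h⁻¹ (b 1 (some x)) := by
      by_cases hx : b 1 (some x) = none
      · rw [hx, hnone, hnone]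
      · exact e _ ⟨by rw [hb, one_mul], hx⟩
    rwa [hb, hb, one_mul, one_mul] at key

theorem numMonogenicInverseSubsemigroups_add_numCyclicSubgroups (m : ℕ) :
    numMonogenicInverseSubsemigroups (m + 1) + numCyclicSubgroups m =
      numMonogenicInverseSubmonoids (m + 1) := by
  have hS : numMonogenicInverseSubsemigroups (m + 1) =
      (Set.range fun s : SymmInvMonoid (Fin (m + 1)) =>
        isoClass (Subsemigroup.closure {s, s⁻¹})).ncard := by
    refine Eq.trans ?_ (numIsoTypes_subtype (fun s => Subsemigroup.closure {s, s⁻¹})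
      Subsemigroup.isMonogenicInverse_iff)
    rfl
  have hN : numMonogenicInverseSubmonoids (m + 1) =
      (Set.range fun s : SymmInvMonoid (Fin (m + 1)) =>
        isoClass (Submonoid.closure {s, s⁻¹})).ncard :=
    numIsoTypes_subtype (fun s => Submonoid.closure {s, s⁻¹}) Submonoid.isMonogenicInverse_iff
  rw [hS, hN]
  let ψ : Equiv.Perm (Fin m) →ₙ* SymmInvMonoid (Fin (m + 1)) :=
    -- The inverse compensates for the opposite composition orders of `Equiv.Perm` and
    -- `SymmInvMonoid`.
    ⟨fun f => (Equiv.Perm.viaEmbeddingHom Fin.castSuccEmb f).symm.toPEquiv,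
      fun f g => by rw [map_mul]; exact Equiv.toPEquiv_trans _ _⟩
  let e (f : Equiv.Perm (Fin m)) (x : Fin (m + 1)) : Option (Fin (m + 1)) :=
    Fin.lastCases (motive := fun _ => Option (Fin (m + 1))) none (fun y => some (f y).castSucc) x
  have he_last : ∀ f, e f (Fin.last m) = none := fun f => Fin.lastCases_last
  have he : ∀ f x, e f (Fin.castSucc x) = some (f x).castSucc := fun f x => Fin.lastCases_castSucc x
  -- Here `χ f` is undefined at the last point, so no target point is needed and `m = 0` is allowed.
  let χ : Equiv.Perm (Fin m) →ₙ* SymmInvMonoid (Fin (m + 1)) :=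
    ⟨fun f =>
      { toFun := e f.symm
        invFun := e f
        inv := fun a b => by
          induction a using Fin.lastCases <;> induction b using Fin.lastCases <;>
            simp [he, he_last, @eq_comm (Fin m), Equiv.eq_symm_apply] },
      fun f g => PEquiv.ext fun x => by
        change e (f * g).symm x = (e f.symm x).bind (e g.symm)
        induction x using Fin.lastCases with
        | last => rw [he_last, he_last, Option.bind_none]
        | cast x => rw [he, he, Option.bind_some, he]; rfl⟩
  have hχ : ∀ f x, (show Fin (m + 1) ≃. Fin (m + 1) from χ f) (Fin.castSucc x) =
      some (f.symm x).castSucc := fun f x => he f.symm x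
  refine ncard_range_closure_add_numCyclicSubgroups (fun s => {s, s⁻¹}) m (fun s => Or.inl rfl)
    (fun s h => ?_) (fun G _ => exists_injective_perm_fin_of_symmInvMonoid) ψ χ ?_ ?_ ?_ ?_ ?_ ?_
  · have hs := SymmInvMonoid.isUnit_of_one_mem_closure h
    exact ⟨hs, Set.pair_subset (Submonoid.mem_powers s) (SymmInvMonoid.inv_mem_powers hs)⟩
  · intro f g h
    apply Equiv.Perm.viaEmbeddingHom_injective Fin.castSuccEmb
    apply Equiv.symm_bijective.injective
    ext1 x
    exact Option.some_injective _ (DFunLike.congr_fun (F := Fin (m + 1) ≃. Fin (m + 1)) h x)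
  · intro f g h
    apply Equiv.symm_bijective.injective
    ext1 x
    have := DFunLike.congr_fun (F := Fin (m + 1) ≃. Fin (m + 1)) h x.castSucc
    rw [hχ f, hχ g] at this
    exact Fin.castSucc_injective m (Option.some_injective _ this)
  · change (Equiv.Perm.viaEmbeddingHom Fin.castSuccEmb
      (1 : Equiv.Perm (Fin m))).symm.toPEquiv = PEquiv.refl _
    rw [map_one]
    rfl
  · intro h
    have := DFunLike.congr_fun (F := Fin (m + 1) ≃. Fin (m + 1)) h (Fin.last m)
    change e (1 : Equiv.Perm (Fin m)).symm (Fin.last m) = some (Fin.last m) at this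
    rw [he_last] at this
    exact Option.some_ne_none _ this.symm
  · intro h
    refine Set.pair_subset ⟨h, Subgroup.mem_zpowers h, rfl⟩
      ⟨h⁻¹, inv_mem (Subgroup.mem_zpowers h), ?_⟩
    change (Equiv.Perm.viaEmbeddingHom Fin.castSuccEmb h⁻¹).symm.toPEquiv = _
    rw [map_inv]
    rfl
  · exact fun h => Set.pair_subset ⟨h, Subgroup.mem_zpowers h, rfl⟩
      ⟨h⁻¹, inv_mem (Subgroup.mem_zpowers h), rfl⟩

theorem mainTheorem2 (n : ℕ) (hn : 1 ≤ n) :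
    (2 ≤ n →
      (numMonogenicSubsemigroups n : ℤ) =
        (numMonogenicSubmonoids n : ℤ) - (numCyclicSubgroups (n - 1) : ℤ)) ∧
    (numMonogenicInverseSubsemigroups n : ℤ) =
      (numMonogenicInverseSubmonoids n : ℤ) - (numCyclicSubgroups (n - 1) : ℤ) := by
  obtain ⟨m, rfl⟩ := Nat.exists_eq_add_of_le' hn
  rw [Nat.add_sub_cancel]
  refine ⟨fun h => ?_, ?_⟩
  · have := numMonogenicSubsemigroups_add_numCyclicSubgroups m (by omega)
    omega
  · have := numMonogenicInverseSubsemigroups_add_numCyclicSubgroups m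
    omega
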